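/- Let $T$ be the rooted dyadic tree of depth $N\in\mathbb N\cup\{\infty\}$: its vertices are the dyadic subintervals of $[0,1)$ of generation at most $N$, ordered by inclusion. Let $T^2=T\times T$ be the bi-tree of dyadic rectangles with the product order (inclusion), with root $o=[0,1)^2$. For functions on $T^2$ put $\mathbb I f(\alpha)=\sum_{\beta\ge\alpha}f(\beta)$, $\mathbb I^*\nu(\alpha)=\sum_{\beta\le\alpha}\nu(\beta)$, $\int_{T^2} h=\sum_{\alpha\in T^2} h(\alpha)$, and for $F\subset T^2$ let $\operatorname{cap}(F)=\inf\{\int_{T^2}\varphi^2:\ \varphi\ge 0,\ \mathbb I\varphi\ge1\text{ on }F\}$. A function $f\ge0$ on $T$ is superadditive if $f(\beta)$ is at least the sum of $f$ over the children of $\beta$, for every $\beta$. Logarithms are to base $2$. **(1)** Small energy majorization fails on $T^2$. For every constant $C$ there is $N_0$ such that for every $N\ge N_0$ (including $N=\infty$) the following statement is false: for all $f,g:T^2\to[0,\infty)$ with $f$ superadditive in each variable, and all $\delta>0$, $\lambda\ge10\delta$ with $\operatorname{supp} f\subset\{\mathbb I g\le\delta\}$, there is $\varphi:T^2\to[0,\infty)$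 with $\mathbb I\varphi\ge\mathbb I f$ on $\{2\lambda\le\mathbb I g\le4\lambda\}$ and $\int_{T^2}\varphi^2\le C\frac{\delta}{\lambda}\int_{T^2}f^2$. **(2)** The weighted version, with $g$ superadditive, fails as well. For all constants $c>0$ and $C$ there is $N_0$ such that for every $N\ge N_0$ (including $N=\infty$) the following statement is false: for all $f,g,w:T^2\to[0,\infty)$ with $g$ superadditive in each variable, and all $\lambda,\delta>0$ with $\mathbb I(wg)\le\delta$ on $\operatorname{supp} f$, there is $\varphi:T^2\to[0,\infty)$ with $\mathbb I(w\varphi)\ge c\,\mathbb I(wf)$ on $\{\lambda/2<\mathbb I(wg)\le2\lambda\}$ and $\int_{T^2} w\varphi^2\le C\frac{\delta}{\lambda}\int_{T^2} wf^2$. **(3)** An explicit example. There are absolute constants $c>0$ and $t_0$ such that the following holds for all integers $t\ge t_0$. Let $s=2^t$ and $n=2^s$ (so $s=\log n$, $t=\log\log n$), let $2^M=n/\log n$, and let the depth of $T$ be at least $n+M$ or infinite. Let $Q_j$, $1\le j\le2^M$, be the dyadic squares of side $2^{-M}$ along the South-West to North-East diagonal of the unit square. Let $\omega_j$ be the dyadic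 square of side $2^{-n}2^{-M}$ in the South-West corner of $Q_j$. For $0\le k\le s$ let $q_{jk}$ be the dyadic rectangle of width $2^{-n/2^k}2^{-M}$ and height $2^{-2^k}2^{-M}$ in the South-West corner of $Q_j$. Let $f$ be the unit mass at the root $o$, let $\nu$ consist of mass $1/n^2$ at each $\omega_j$, and put $g=\mathbb I^*\nu$, $\delta=\frac1{n\log n}$, $\lambda=\frac1{2n}$. Let $$F=\{q_{jk}:\ 1\le j\le 2^M,\ \log\log n\le k\le\log n-\log\log n\},$$ and let $F_{\mathrm{all}}$ be the set of all $q_{jk}$, $1\le j\le2^M$, $0\le k\le\log n$. Then: * $f=\mathbb I^*f$ is superadditive in each variable, so is $g$, $\operatorname{supp} f\subset\{\mathbb I g\le\delta\}$, $\delta>0$, $\lambda\ge10\delta$, $g(o)=\delta$, and $\mathbb I f\equiv1$; * $F\subset\{2\lambda\le\mathbb I g\le4\lambda\}$; * $c\le\operatorname{cap}(F)\le1$ and $c\le\operatorname{cap}(F_{\mathrm{all}})\le1$ (so these capacities are $\asymp1$, not $O(1/\log n)$); * if $\varphi\ge0$ satisfies $\mathbb I\varphi\ge\mathbb I f$ on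 $\{2\lambda\le\mathbb I g\le4\lambda\}$ and $\int_{T^2}\varphi^2\le C\frac\delta\lambda\int_{T^2}f^2$, then $C\ge\frac c2\log n$. -/

import Mathlib

open scoped NNReal ENNReal

noncomputable section

/-- The rooted dyadic tree of depth `N`, where `N = ⊤` gives the infinite dyadic tree.  Its vertices
are the dyadic intervals `[idx / 2 ^ gen, (idx + 1) / 2 ^ gen)` of `[0, 1)` of generation
`gen ≤ N`. -/
@[ext]
structure DyadicTree (N : ℕ∞) where
  gen : ℕ
  idx : ℕ
  gen_le : (gen : ℕ∞) ≤ N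
  idx_lt : idx < 2 ^ gen

namespace DyadicTree

variable {N : ℕ∞}

/-- `α ≤ β` means that the interval `α` is contained in the interval `β`, i.e. that `β` is the
ancestor of `α` of generation `β.gen`.  The root is the largest vertex. -/
instance : LE (DyadicTree N) where
  le α β := β.gen ≤ α.gen ∧ α.idx / 2 ^ (α.gen - β.gen) = β.idx

theorem le_def {α β : DyadicTree N} :
    α ≤ β ↔ β.gen ≤ α.gen ∧ α.idx / 2 ^ (α.gen - β.gen) = β.idx := Iff.rfl

instance : PartialOrder (DyadicTree N) where
  le_refl α := ⟨le_rfl, by simp⟩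
  le_trans α β γ h₁ h₂ := by
    obtain ⟨h₁, e₁⟩ := h₁
    obtain ⟨h₂, e₂⟩ := h₂
    refine ⟨h₂.trans h₁, ?_⟩
    rw [← e₂, ← e₁, Nat.div_div_eq_div_mul, ← pow_add]
    congr 2
    omega
  le_antisymm α β h₁ h₂ := by
    have hg : α.gen = β.gen := le_antisymm h₂.1 h₁.1
    refine DyadicTree.ext hg ?_
    have := h₁.2
    simpa [hg] using this

instance : DecidableEq (DyadicTree N) := Classical.decEq _

instance : DecidableLE (DyadicTree N) := Classical.decRel _

theorem finite_Ici (α : DyadicTree N) : (Set.Ici α).Finite := by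
  refine Set.Finite.of_finite_image (f := DyadicTree.gen)
    ((Set.finite_Iic α.gen).subset ?_) ?_
  · rintro _ ⟨β, hβ, rfl⟩
    exact hβ.1
  · intro β hβ γ hγ h
    refine DyadicTree.ext h ?_
    have h₁ := hβ.2
    have h₂ := hγ.2
    rw [← h₁, ← h₂, h]

/-- Every vertex has finitely many ancestors. -/
instance : LocallyFiniteOrderTop (DyadicTree N) :=
  LocallyFiniteOrderTop.ofIci _ (fun α => (finite_Ici α).toFinset) (by simp)

/-- The root `[0, 1)`. -/
def root (N : ℕ∞) : DyadicTree N := ⟨0, 0, zero_le, by simp⟩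

/-- `α` is the leftmost dyadic subinterval of relative generation `a` of the `j`-th
(`j = 0, 1, …`) dyadic interval of length `2 ^ (-M)`, that is,
`α = [j 2 ^ (-M), j 2 ^ (-M) + 2 ^ (-a) 2 ^ (-M))`. -/
def IsCorner (M a j : ℕ) (α : DyadicTree N) : Prop :=
  α.gen = M + a ∧ α.idx = j * 2 ^ a

/-- Superadditivity on the tree: `g β` is at least the sum of `g` over the children of `β`,
which are the maximal vertices strictly below `β`. -/
def Superadditive (g : DyadicTree N → ℝ≥0) : Prop :=
  ∀ (β : DyadicTree N) (S : Finset (DyadicTree N)), (∀ α ∈ S, α ⋖ β) → ∑ α ∈ S, g α ≤ g β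

end DyadicTree

/-- The bi-tree `T²`: dyadic rectangles in the unit square, ordered by inclusion
(the product order). -/
abbrev BiTree (N : ℕ∞) : Type := DyadicTree N × DyadicTree N

namespace BiTree

variable {N : ℕ∞}

/-- The operator `𝕀` of summation up the graph. -/
def upSum (f : BiTree N → ℝ≥0) (α : BiTree N) : ℝ≥0 := ∑ β ∈ Finset.Ici α, f β

/-- The operator `𝕀*` of summation down the graph, `α ↦ ν {β | β ≤ α}`, for a finite measure
on the vertices given by its point masses `ν β`. -/
def downSum (ν : BiTree N → ℝ≥0) (α : BiTree N) : ℝ≥0 := ∑' β : Set.Iic α, ν β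

/-- The energy `∫ φ²` with respect to the counting measure. -/
def energy (φ : BiTree N → ℝ≥0) : ℝ≥0∞ := ∑' α, (φ α : ℝ≥0∞) ^ 2

/-- The capacity of a set of vertices. -/
def cap (F : Set (BiTree N)) : ℝ≥0∞ :=
  ⨅ (φ : BiTree N → ℝ≥0) (_ : ∀ α ∈ F, 1 ≤ upSum φ α), energy φ

/-- Superadditivity in each of the two variables. -/
def BiSuperadditive (f : BiTree N → ℝ≥0) : Prop :=
  (∀ y, DyadicTree.Superadditive fun x => f (x, y)) ∧
    ∀ x, DyadicTree.Superadditive fun y => f (x, y)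

/-- The set `{2 lam ≤ 𝕀 g ≤ 4 lam}`. -/
def levelSet (g : BiTree N → ℝ≥0) (lam : ℝ≥0) : Set (BiTree N) :=
  {α | 2 * lam ≤ upSum g α ∧ upSum g α ≤ 4 * lam}

/-- `φ` is a small energy majorant of `f` with constant `C`, for the given `g`, `δ`, `lam`. -/
def IsMajorant (C : ℝ≥0) (f g : BiTree N → ℝ≥0) (δ lam : ℝ≥0) (φ : BiTree N → ℝ≥0) : Prop :=
  (∀ α ∈ levelSet g lam, upSum f α ≤ upSum φ α) ∧
    energy φ ≤ ((C * (δ / lam) : ℝ≥0) : ℝ≥0∞) * energy f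

/-- The hypotheses of the small energy majorization conjecture. -/
def MajorizationData (f g : BiTree N → ℝ≥0) (δ lam : ℝ≥0) : Prop :=
  0 < δ ∧ 10 * δ ≤ lam ∧ BiSuperadditive f ∧ ∀ α, f α ≠ 0 → upSum g α ≤ δ

/-- Small energy majorization on the bi-tree of depth `N`, with constant `C`. -/
def Majorization (N : ℕ∞) (C : ℝ≥0) : Prop :=
  ∀ (f g : BiTree N → ℝ≥0) (δ lam : ℝ≥0), MajorizationData f g δ lam →
    ∃ φ : BiTree N → ℝ≥0, IsMajorant C f g δ lam φ

/-- The weighted majorization on the bi-tree of depth `N` in which `g` instead of `f` is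
superadditive, with constants `c` (majorization) and `C` (energy). -/
def WeightedMajorization (N : ℕ∞) (c C : ℝ≥0) : Prop :=
  ∀ (f g w : BiTree N → ℝ≥0) (δ lam : ℝ≥0), 0 < δ → 0 < lam → BiSuperadditive g →
    (∀ α, f α ≠ 0 → upSum (fun β => w β * g β) α ≤ δ) →
    ∃ φ : BiTree N → ℝ≥0,
      (∀ α, lam / 2 < upSum (fun β => w β * g β) α → upSum (fun β => w β * g β) α ≤ 2 * lam →
        c * upSum (fun β => w β * f β) α ≤ upSum (fun β => w β * φ β) α) ∧
      ∑' α, (w α : ℝ≥0∞) * (φ α : ℝ≥0∞) ^ 2 ≤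
        ((C * (δ / lam) : ℝ≥0) : ℝ≥0∞) * ∑' α, (w α : ℝ≥0∞) * (f α : ℝ≥0∞) ^ 2

/-- The unit point mass at the root of the bi-tree. -/
def rootDelta (N : ℕ∞) : BiTree N → ℝ≥0 := Pi.single (DyadicTree.root N, DyadicTree.root N) 1

open Classical in
/-- With `n = 2 ^ s`: mass `1 / n ^ 2` at each of the `2 ^ M` squares `ω_j`, where `ω_j` is the
South-West corner square of side `2 ^ (-n) 2 ^ (-M)` of the `j`-th dyadic square `Q_j` of side
`2 ^ (-M)` on the diagonal of the unit square. -/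
def nu (N : ℕ∞) (s M : ℕ) : BiTree N → ℝ≥0 := fun α =>
  if ∃ j < 2 ^ M, α.1.IsCorner M (2 ^ s) j ∧ α.2.IsCorner M (2 ^ s) j
  then 1 / ((2 : ℝ≥0) ^ s) ^ 2 else 0

/-- With `n = 2 ^ s`: the family of all `q_{jk}`, `0 ≤ j < 2 ^ M`, `a ≤ k ≤ b`, where `q_{jk}` is
the rectangle of width `2 ^ (-n / 2 ^ k) 2 ^ (-M)` and height `2 ^ (-2 ^ k) 2 ^ (-M)` at the
South-West corner of `Q_j` (used for `b ≤ s`, so that `n / 2 ^ k` is the integer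
`2 ^ (s - k)`). -/
def rects (N : ℕ∞) (s M a b : ℕ) : Set (BiTree N) :=
  {α | ∃ j < 2 ^ M, ∃ k ∈ Finset.Icc a b,
    α.1.IsCorner M (2 ^ (s - k)) j ∧ α.2.IsCorner M (2 ^ k) j}

end BiTree

end

/-!
All three parts rest on one estimate: the capacity of the family `F` of the rectangles `q_{jk}`,
`t ≤ k ≤ s - t`, is at least `1 / 23` (`BiTree.le_cap_rects`).

The kernel of `𝕀 𝕀*` is the number of common ancestors, `𝕀 𝕀* ν (α) = ∑ ν(γ) |{β ≥ α, β ≥ γ}|`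
(`BiTree.upSum_downSum`), and on the bi-tree this number is the product of the numbers of common
ancestors of the two sides. With `n = 2 ^ s` and `P = 2 ^ M = n / s` the numbers are as follows.

* For vertices inside different diagonal squares `Q_j`, `Q_{j'}`, it is at most the square of the
  number of dyadic squares containing both, and averaged over `j'` this is at most `6`
  (`sum_sq_agree_le`).
* For `q_{jk}` and `q_{jk'}` inside the same `Q_j` it is about `n 2 ^ (-|k - k'|)`, up to terms
  containing the generation `M` of `Q_j`; the restriction `t ≤ k ≤ s - t` makes those harmless.

Testing with the uniform probability measure `μ` on `F`, the energy `∫ (𝕀* μ)²` is the average number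
of common ancestors of two members of `F`. Different squares contribute `O(1)`. Equal squares have
probability `1 / P`, and averaging over the about `s` values of `k` and `k'` turns the geometric
series into `O(n / s)`, so that they contribute `O(n / (s P)) = O(1)` (`BiTree.sum_common_le`). By
duality the capacity of `F` is bounded below (`BiTree.sq_card_le_common_mul_energy`).

The same counts give `1 / n ≤ 𝕀 g ≤ 2 / n` on `F` (`BiTree.rects_subset_levelSet`). Since
`𝕀 f ≡ 1` for the unit mass `f` at the root, a majorant of `𝕀 f` on the level set has energy at least
the capacity of `F`, whereas small energy majorization would provide one of energy
`O(C / log n)`. The weighted version is refuted by the same data with weight `1`.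
-/

/-! ### Ancestors in the dyadic tree -/

namespace DyadicTree

variable {N : ℕ∞}

theorem le_root (x : DyadicTree N) : x ≤ root N :=
  ⟨Nat.zero_le _, by simpa [root] using Nat.div_eq_of_lt x.idx_lt⟩

theorem gen_injOn_Ici (x : DyadicTree N) : Set.InjOn gen (Set.Ici x) := by
  intro β hβ γ hγ h
  refine DyadicTree.ext h ?_
  rw [← hβ.2, ← hγ.2, h]

/-- A vertex has exactly one ancestor of each generation up to its own. -/
theorem card_Ici (x : DyadicTree N) : (Finset.Ici x).card = x.gen + 1 := by
  rw [← Finset.card_range (x.gen + 1)]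
  refine Finset.card_bij (fun β _ => β.gen) ?_ ?_ ?_
  · intro β hβ
    have := (Finset.mem_Ici.1 hβ).1
    simp only [Finset.mem_range]
    omega
  · intro β hβ γ hγ h
    exact gen_injOn_Ici x (Finset.mem_Ici.1 hβ) (Finset.mem_Ici.1 hγ) h
  · intro m hm
    have hm' : m ≤ x.gen := Nat.lt_succ_iff.1 (Finset.mem_range.1 hm)
    refine ⟨⟨m, x.idx / 2 ^ (x.gen - m), ?_, ?_⟩, Finset.mem_Ici.2 ⟨hm', rfl⟩, rfl⟩
    · exact le_trans (by exact_mod_cast hm') x.gen_le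
    · rw [Nat.div_lt_iff_lt_mul (by positivity), ← pow_add, Nat.add_sub_cancel' hm']
      exact x.idx_lt

theorem le_total_of_common_lower {γ α β : DyadicTree N} (h₁ : γ ≤ α) (h₂ : γ ≤ β) :
    α ≤ β ∨ β ≤ α := by
  have key : ∀ α β : DyadicTree N, γ ≤ α → γ ≤ β → β.gen ≤ α.gen → α ≤ β := by
    intro α β h₁ h₂ h
    refine ⟨h, ?_⟩
    rw [← h₁.2, ← h₂.2, Nat.div_div_eq_div_mul, ← pow_add]
    have := h₁.1
    congr 2
    omega
  rcases le_total β.gen α.gen with h | h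
  · exact Or.inl (key α β h₁ h₂ h)
  · exact Or.inr (key β α h₂ h₁ h)

theorem eq_of_covBy_of_le {γ α α' β : DyadicTree N} (h : α ⋖ β) (h' : α' ⋖ β)
    (hγ : γ ≤ α) (hγ' : γ ≤ α') : α = α' := by
  by_contra hne
  rcases le_total_of_common_lower hγ hγ' with hle | hle
  · exact h.2 (lt_of_le_of_ne hle hne) h'.1
  · exact h'.2 (lt_of_le_of_ne hle (Ne.symm hne)) h.1

theorem IsCorner.exists {M a j : ℕ} (hN : ((M + a : ℕ) : ℕ∞) ≤ N) (hj : j < 2 ^ M) :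
    ∃ x : DyadicTree N, IsCorner M a j x :=
  ⟨⟨M + a, j * 2 ^ a, hN, by rw [pow_add]; gcongr⟩, rfl, rfl⟩

theorem IsCorner.le {M a b j : ℕ} {x y : DyadicTree N} (hx : IsCorner M a j x)
    (hy : IsCorner M b j y) (hab : b ≤ a) : x ≤ y := by
  refine ⟨by rw [hx.1, hy.1]; omega, ?_⟩
  rw [hx.1, hx.2, hy.1, hy.2, Nat.add_sub_add_left]
  refine Nat.div_eq_of_eq_mul_left (by positivity) ?_
  rw [mul_assoc, ← pow_add, Nat.add_sub_cancel' hab]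

theorem IsCorner.unique {M a j : ℕ} {x y : DyadicTree N} (hx : IsCorner M a j x)
    (hy : IsCorner M a j y) : x = y :=
  DyadicTree.ext (hx.1.trans hy.1.symm) (hx.2.trans hy.2.symm)

theorem IsCorner.idx_inj {M a j j' : ℕ} {x : DyadicTree N} (hx : IsCorner M a j x)
    (hx' : IsCorner M a j' x) : j = j' :=
  Nat.eq_of_mul_eq_mul_right (by positivity) (hx.2.symm.trans hx'.2)

/-- The number of common ancestors of two vertices. -/
noncomputable def common (x y : DyadicTree N) : ℕ := (Finset.Ici x ∩ Finset.Ici y).card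

theorem common_le_left (x y : DyadicTree N) : common x y ≤ x.gen + 1 :=
  (Finset.card_le_card Finset.inter_subset_left).trans (card_Ici x).le

theorem common_le_right (x y : DyadicTree N) : common x y ≤ y.gen + 1 :=
  (Finset.card_le_card Finset.inter_subset_right).trans (card_Ici y).le

theorem common_of_le {x y : DyadicTree N} (h : x ≤ y) : common x y = y.gen + 1 := by
  rw [common, Finset.inter_eq_right.2 (Finset.Ici_subset_Ici.2 h), card_Ici]

end DyadicTree

/-- The generations below `M` at which the dyadic ancestors of the `j`-th and of the `j'`-th
interval of length `2 ^ (-M)` coincide. -/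
def agree (M j j' : ℕ) : Finset ℕ :=
  (Finset.range M).filter fun m => j / 2 ^ (M - m) = j' / 2 ^ (M - m)

/-- Vertices hanging below different intervals of generation `M` only share ancestors of those
intervals. -/
theorem DyadicTree.IsCorner.common_le_agree {N : ℕ∞} {M a a' j j' : ℕ} {x x' : DyadicTree N}
    (hx : IsCorner M a j x) (hx' : IsCorner M a' j' x') (hj : j ≠ j') :
    common x x' ≤ (agree M j j').card := by
  refine Finset.card_le_card_of_injOn gen ?_ ?_
  · intro β hβ
    simp only [Finset.coe_inter, Finset.coe_Ici, Set.mem_inter_iff, Set.mem_Ici] at hβ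
    have key : ∀ {a j : ℕ} {x : DyadicTree N}, IsCorner M a j x → x ≤ β →
        (M ≤ β.gen → β.idx / 2 ^ (β.gen - M) = j) ∧
          (β.gen < M → β.idx = j / 2 ^ (M - β.gen)) := by
      intro a j x hx hle
      obtain ⟨hg, hi⟩ := hle
      rw [hx.1] at hg
      rw [hx.1, hx.2] at hi
      constructor
      · intro h
        rw [← hi, Nat.div_div_eq_div_mul, ← pow_add,
          show M + a - β.gen + (β.gen - M) = a by omega, Nat.mul_div_cancel _ (by positivity)]
      · intro h
        rw [← hi, show M + a - β.gen = a + (M - β.gen) by omega, pow_add,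
          ← Nat.div_div_eq_div_mul, Nat.mul_div_cancel _ (by positivity)]
    have h₁ := key hx hβ.1
    have h₂ := key hx' hβ.2
    have hlt : β.gen < M := by
      by_contra hcon
      exact hj ((h₁.1 (not_lt.1 hcon)).symm.trans (h₂.1 (not_lt.1 hcon)))
    simp only [agree, Finset.coe_filter, Finset.mem_range, Set.mem_ofPred_eq]
    exact ⟨hlt, (h₁.2 hlt).symm.trans (h₂.2 hlt)⟩
  · exact (gen_injOn_Ici x).mono (by simp)

/-! ### Average number of common generations of diagonal squares -/

/-- Distinct natural numbers are at least as large as `0, 1, 2, …`, and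
`1 + 3 + 5 + ⋯` are the squares. -/
theorem sq_card_le_sum_odd (S : Finset ℕ) : S.card ^ 2 ≤ ∑ m ∈ S, (2 * m + 1) := by
  induction S using Finset.induction_on_max with
  | empty => simp
  | insert a s ha ih =>
    have hna : a ∉ s := fun h => lt_irrefl _ (ha a h)
    have hc : s.card ≤ a := by
      have : s ⊆ Finset.range a := fun x hx => Finset.mem_range.2 (ha x hx)
      simpa using Finset.card_le_card this
    rw [Finset.card_insert_of_notMem hna, Finset.sum_insert hna]
    nlinarith

theorem card_filter_div_eq_le (P d q : ℕ) (hd : 0 < d) :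
    ((Finset.range P).filter fun i => q = i / d).card ≤ d := by
  have : ((Finset.range P).filter fun i => q = i / d) ⊆ Finset.Ico (q * d) (q * d + d) := by
    intro i hi
    have h := (Finset.mem_filter.1 hi).2.symm
    rw [Nat.div_eq_iff hd] at h
    rw [Finset.mem_Ico]
    omega
  simpa using Finset.card_le_card this

theorem sum_odd_mul_two_pow (M : ℕ) :
    ∑ m ∈ Finset.range M, (2 * m + 1) * 2 ^ (M - m) + (4 * M + 6) = 6 * 2 ^ M := by
  induction M with
  | zero => simp
  | succ M ih =>
    have : ∑ m ∈ Finset.range M, (2 * m + 1) * 2 ^ (M + 1 - m)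
        = 2 * ∑ m ∈ Finset.range M, (2 * m + 1) * 2 ^ (M - m) := by
      rw [Finset.mul_sum]
      refine Finset.sum_congr rfl fun m hm => ?_
      rw [Nat.succ_sub (Finset.mem_range.1 hm).le, pow_succ]
      ring
    rw [Finset.sum_range_succ, this, pow_succ]
    simp only [Nat.add_sub_cancel_left, pow_one]
    omega

/-- The interaction of one diagonal square with all the others is on average bounded: two
squares of the diagonal have at least `m` common generations with probability `2 ^ (-m)`. -/
theorem sum_sq_agree_le (M j : ℕ) :
    ∑ j' ∈ Finset.range (2 ^ M), (agree M j j').card ^ 2 ≤ 6 * 2 ^ M := by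
  calc ∑ j' ∈ Finset.range (2 ^ M), (agree M j j').card ^ 2
      ≤ ∑ j' ∈ Finset.range (2 ^ M), ∑ m ∈ Finset.range M,
          if j / 2 ^ (M - m) = j' / 2 ^ (M - m) then 2 * m + 1 else 0 := by
        refine Finset.sum_le_sum fun j' _ => (sq_card_le_sum_odd _).trans ?_
        rw [agree, Finset.sum_filter]
    _ = ∑ m ∈ Finset.range M, (2 * m + 1) *
          ((Finset.range (2 ^ M)).filter fun j' => j / 2 ^ (M - m) = j' / 2 ^ (M - m)).card := by
        rw [Finset.sum_comm]
        refine Finset.sum_congr rfl fun m _ => ?_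
        rw [← Finset.sum_filter, Finset.sum_const, smul_eq_mul, mul_comm]
    _ ≤ ∑ m ∈ Finset.range M, (2 * m + 1) * 2 ^ (M - m) := by
        gcongr
        exact card_filter_div_eq_le _ _ _ (by positivity)
    _ ≤ 6 * 2 ^ M := by
        have := sum_odd_mul_two_pow M
        omega

/-! ### Potentials and capacity on the bi-tree -/

namespace BiTree

variable {N : ℕ∞}

/-- The number of common ancestors of two vertices of the bi-tree. -/
noncomputable def common (p q : BiTree N) : ℕ := (Finset.Ici p ∩ Finset.Ici q).card

theorem common_eq_mul (p q : BiTree N) :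
    common p q = DyadicTree.common p.1 q.1 * DyadicTree.common p.2 q.2 := by
  obtain ⟨p₁, p₂⟩ := p
  obtain ⟨q₁, q₂⟩ := q
  rw [common, ← Finset.Ici_product_Ici, ← Finset.Ici_product_Ici, Finset.product_inter_product,
    Finset.card_product]
  rfl

theorem le_root (α : BiTree N) : α ≤ (DyadicTree.root N, DyadicTree.root N) :=
  ⟨DyadicTree.le_root _, DyadicTree.le_root _⟩

theorem downSum_eq_sum {ν : BiTree N → ℝ≥0} {T : Finset (BiTree N)} (hT : ∀ γ, ν γ ≠ 0 → γ ∈ T)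
    (α : BiTree N) : downSum ν α = ∑ γ ∈ T with γ ≤ α, ν γ := by
  classical
  rw [downSum, tsum_subtype (Set.Iic α) ν, tsum_eq_sum (s := T), Finset.sum_filter]
  · refine Finset.sum_congr rfl fun γ _ => ?_
    by_cases h : γ ≤ α <;> simp [Set.indicator, h]
  · intro γ hγ
    have : ν γ = 0 := by_contra fun h => hγ (hT γ h)
    simp [Set.indicator, this]

/-- The kernel of `𝕀 𝕀*` counts common ancestors. -/
theorem upSum_downSum {ν : BiTree N → ℝ≥0} {T : Finset (BiTree N)} (hT : ∀ γ, ν γ ≠ 0 → γ ∈ T)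
    (α : BiTree N) : upSum (downSum ν) α = ∑ γ ∈ T, ν γ * common α γ := by
  simp_rw [upSum, downSum_eq_sum hT, Finset.sum_filter]
  rw [Finset.sum_comm]
  refine Finset.sum_congr rfl fun γ _ => ?_
  rw [← Finset.sum_filter, Finset.sum_const, nsmul_eq_mul, mul_comm, common]
  congr 3
  ext β
  simp

theorem sum_downSum_le {ν : BiTree N → ℝ≥0} {T : Finset (BiTree N)} (hT : ∀ γ, ν γ ≠ 0 → γ ∈ T)
    {S : Finset (DyadicTree N)} {e : DyadicTree N → BiTree N} {β : BiTree N}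
    (hle : ∀ x ∈ S, e x ≤ β)
    (hdis : ∀ x ∈ S, ∀ x' ∈ S, ∀ γ, γ ≤ e x → γ ≤ e x' → x = x') :
    ∑ x ∈ S, downSum ν (e x) ≤ downSum ν β := by
  classical
  simp_rw [downSum_eq_sum hT]
  rw [← Finset.sum_biUnion]
  · refine Finset.sum_le_sum_of_subset fun γ hγ => ?_
    simp only [Finset.mem_biUnion, Finset.mem_filter] at hγ ⊢
    obtain ⟨x, hx, hγT, hγ⟩ := hγ
    exact ⟨hγT, hγ.trans (hle x hx)⟩
  · intro x hx x' hx' hne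
    rw [Function.onFun, Finset.disjoint_left]
    intro γ h₁ h₂
    exact hne (hdis x hx x' hx' γ (Finset.mem_filter.1 h₁).2 (Finset.mem_filter.1 h₂).2)

theorem biSuperadditive_downSum {ν : BiTree N → ℝ≥0} {T : Finset (BiTree N)}
    (hT : ∀ γ, ν γ ≠ 0 → γ ∈ T) : BiSuperadditive (downSum ν) := by
  constructor
  · intro y β S hS
    exact sum_downSum_le hT (e := fun x => (x, y)) (fun x hx => ⟨(hS x hx).1.le, le_rfl⟩)
      fun x hx x' hx' γ h₁ h₂ => DyadicTree.eq_of_covBy_of_le (hS x hx) (hS x' hx') h₁.1 h₂.1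
  · intro x β S hS
    exact sum_downSum_le hT (e := fun y => (x, y)) (fun y hy => ⟨le_rfl, (hS y hy).1.le⟩)
      fun y hy y' hy' γ h₁ h₂ => DyadicTree.eq_of_covBy_of_le (hS y hy) (hS y' hy') h₁.2 h₂.2

theorem upSum_rootDelta (α : BiTree N) : upSum (rootDelta N) α = 1 := by
  rw [upSum, rootDelta, Finset.sum_pi_single']
  simp [le_root]

theorem mem_singleton_of_rootDelta_ne_zero (γ : BiTree N) (h : rootDelta N γ ≠ 0) :
    γ ∈ ({(DyadicTree.root N, DyadicTree.root N)} : Finset (BiTree N)) := by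
  rw [Finset.mem_singleton]
  by_contra hne
  exact h (Pi.single_eq_of_ne hne _)

theorem downSum_rootDelta : downSum (rootDelta N) = rootDelta N := by
  funext α
  rw [downSum_eq_sum mem_singleton_of_rootDelta_ne_zero, Finset.sum_filter, Finset.sum_singleton]
  by_cases h : α = (DyadicTree.root N, DyadicTree.root N)
  · simp [h]
  · rw [if_neg fun h' => h (le_antisymm (le_root α) h'), rootDelta, Pi.single_eq_of_ne h]

theorem energy_rootDelta : energy (rootDelta N) = 1 := by
  rw [energy, tsum_eq_single (DyadicTree.root N, DyadicTree.root N)]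
  · simp [rootDelta]
  · intro α hα
    simp [rootDelta, Pi.single_eq_of_ne hα]

theorem cap_le_one (F : Set (BiTree N)) : cap F ≤ 1 :=
  (iInf₂_le (rootDelta N) fun α _ => (upSum_rootDelta α).ge).trans energy_rootDelta.le

theorem cap_mono {F G : Set (BiTree N)} (h : F ⊆ G) : cap F ≤ cap G :=
  le_iInf₂ fun φ hφ => iInf₂_le φ fun α hα => hφ α (h hα)

/-- The dual bound for capacity, for the uniform measure `μ` on a finite family of vertices:
`μ(F) ≤ ∫ 𝕀φ dμ = ∫ φ 𝕀*μ`, the Cauchy–Schwarz inequality applies, and the energy `∫ (𝕀*μ)²` is a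
sum of numbers of common ancestors. -/
theorem sq_card_le_common_mul_energy {ι : Type*} (S : Finset ι) (p : ι → BiTree N)
    (φ : BiTree N → ℝ≥0) (hφ : ∀ i ∈ S, 1 ≤ upSum φ (p i)) :
    (S.card : ℝ≥0∞) ^ 2 ≤ ((∑ i ∈ S, ∑ i' ∈ S, common (p i) (p i') : ℕ) : ℝ≥0∞) * energy φ := by
  classical
  let U : Finset (BiTree N) := S.biUnion fun i => Finset.Ici (p i)
  let h : BiTree N → ℝ≥0 := fun β => ∑ i ∈ S, if p i ≤ β then 1 else 0
  have hUsum : ∀ ψ : BiTree N → ℝ≥0, ∀ i ∈ S,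
      ∑ β ∈ U, (if p i ≤ β then ψ β else 0) = ∑ β ∈ Finset.Ici (p i), ψ β := by
    intro ψ i hi
    rw [← Finset.sum_filter]
    refine Finset.sum_congr ?_ fun _ _ => rfl
    ext β
    simp only [U, Finset.mem_filter, Finset.mem_biUnion, Finset.mem_Ici]
    exact ⟨fun h => h.2, fun h => ⟨⟨i, hi, h⟩, h⟩⟩
  have h₁ : (S.card : ℝ≥0) ≤ ∑ β ∈ U, h β * φ β := by
    calc (S.card : ℝ≥0) = ∑ i ∈ S, 1 := by simp
      _ ≤ ∑ i ∈ S, upSum φ (p i) := Finset.sum_le_sum hφ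
      _ = ∑ i ∈ S, ∑ β ∈ U, if p i ≤ β then φ β else 0 :=
          Finset.sum_congr rfl fun i hi => (hUsum φ i hi).symm
      _ = ∑ β ∈ U, h β * φ β := by
          rw [Finset.sum_comm]
          refine Finset.sum_congr rfl fun β _ => ?_
          simp only [h, Finset.sum_mul, ite_mul, one_mul, zero_mul]
  have h₂ : ∑ β ∈ U, h β ^ 2 = ((∑ i ∈ S, ∑ i' ∈ S, common (p i) (p i') : ℕ) : ℝ≥0) := by
    simp_rw [h, sq, Finset.sum_mul_sum]
    rw [Finset.sum_comm]
    push_cast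
    refine Finset.sum_congr rfl fun i hi => ?_
    rw [Finset.sum_comm]
    refine Finset.sum_congr rfl fun i' _ => ?_
    simp_rw [ite_mul, one_mul, zero_mul]
    rw [hUsum _ i hi, ← Finset.sum_filter, Finset.sum_const, nsmul_eq_mul, mul_one, common]
    congr 2
    ext β
    simp
  have h₃ : (S.card : ℝ≥0) ^ 2 ≤
      ((∑ i ∈ S, ∑ i' ∈ S, common (p i) (p i') : ℕ) : ℝ≥0) * ∑ β ∈ U, φ β ^ 2 := by
    rw [← h₂]
    exact (pow_le_pow_left' h₁ 2).trans (Finset.sum_mul_sq_le_sq_mul_sq U h φ)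
  have h₄ : ((∑ β ∈ U, φ β ^ 2 : ℝ≥0) : ℝ≥0∞) ≤ energy φ := by
    push_cast
    exact ENNReal.sum_le_tsum U
  calc (S.card : ℝ≥0∞) ^ 2 = (((S.card : ℝ≥0) ^ 2 : ℝ≥0) : ℝ≥0∞) := by push_cast; rfl
    _ ≤ ((((∑ i ∈ S, ∑ i' ∈ S, common (p i) (p i') : ℕ) : ℝ≥0) * ∑ β ∈ U, φ β ^ 2 : ℝ≥0) :
          ℝ≥0∞) := ENNReal.coe_le_coe.2 h₃
    _ ≤ _ := by
        rw [ENNReal.coe_mul, ENNReal.coe_natCast]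
        gcongr

end BiTree

/-! ### Geometric sums over the rectangles of one square -/

theorem sum_two_pow_le {I : Finset ℕ} {b : ℕ} (h : ∀ k ∈ I, k ≤ b) :
    ∑ k ∈ I, 2 ^ k ≤ 2 * 2 ^ b := by
  rw [← pow_succ']
  exact (Nat.geomSum_lt le_rfl fun k hk => Nat.lt_succ_of_le (h k hk)).le

theorem sum_two_pow_sub_le {I : Finset ℕ} {s t : ℕ} (h : ∀ k ∈ I, t ≤ k ∧ k ≤ s) :
    ∑ k ∈ I, 2 ^ (s - k) ≤ 2 * 2 ^ (s - t) := by
  have hinj : Set.InjOn (fun k => s - k) (I : Set ℕ) := by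
    intro k hk k' hk' (e : s - k = s - k')
    have h₁ := h k hk
    have h₂ := h k' hk'
    omega
  rw [← Finset.sum_image (f := fun i => 2 ^ i) hinj]
  refine sum_two_pow_le fun i hi => ?_
  obtain ⟨k, hk, rfl⟩ := Finset.mem_image.1 hi
  have := h k hk
  omega

/-- The summand is `2 ^ s` times `2 ^ (-|k - k'|)`; it is the product of the relative generations of
the smallest rectangle containing `q_{jk}` and `q_{jk'}`. -/
theorem sum_sum_two_pow_le {I : Finset ℕ} {s : ℕ} (h : ∀ k ∈ I, k ≤ s) :
    ∑ k ∈ I, ∑ k' ∈ I, 2 ^ (s - max k k') * 2 ^ min k k' ≤ 4 * I.card * 2 ^ s := by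
  let T : ℕ → ℕ → ℕ := fun k k' => if k' ≤ k then 2 ^ (s - k) * 2 ^ k' else 0
  have hT : ∑ k ∈ I, ∑ k' ∈ I, T k k' ≤ 2 * I.card * 2 ^ s := by
    calc ∑ k ∈ I, ∑ k' ∈ I, T k k' ≤ ∑ k ∈ I, 2 * 2 ^ s := by
          refine Finset.sum_le_sum fun k hk => ?_
          rw [← Finset.sum_filter, ← Finset.mul_sum]
          calc 2 ^ (s - k) * ∑ k' ∈ I with k' ≤ k, 2 ^ k' ≤ 2 ^ (s - k) * (2 * 2 ^ k) := by
                gcongr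
                exact sum_two_pow_le fun k' hk' => (Finset.mem_filter.1 hk').2
            _ = 2 * 2 ^ s := by
                rw [mul_left_comm, ← pow_add, Nat.sub_add_cancel (h k hk)]
      _ = 2 * I.card * 2 ^ s := by rw [Finset.sum_const, smul_eq_mul]; ring
  calc ∑ k ∈ I, ∑ k' ∈ I, 2 ^ (s - max k k') * 2 ^ min k k'
      ≤ ∑ k ∈ I, ∑ k' ∈ I, (T k k' + T k' k) := by
        gcongr with k _ k' _
        rcases le_total k' k with hk | hk
        · simp [T, hk]
        · simp [T, hk]
    _ = ∑ k ∈ I, ∑ k' ∈ I, T k k' + ∑ k ∈ I, ∑ k' ∈ I, T k k' := by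
        simp_rw [Finset.sum_add_distrib]
        congr 1
        exact Finset.sum_comm
    _ ≤ 4 * I.card * 2 ^ s := by linarith

theorem sum_sum_overlap_le {I : Finset ℕ} {s t M : ℕ} (h : ∀ k ∈ I, t ≤ k ∧ k ≤ s - t) :
    ∑ k ∈ I, ∑ k' ∈ I, (M + 1 + 2 ^ (s - max k k')) * (M + 1 + 2 ^ min k k') ≤
      (M + 1) ^ 2 * I.card ^ 2 + 4 * (M + 1) * I.card * 2 ^ (s - t) + 4 * I.card * 2 ^ s := by
  have h₁ : ∑ k ∈ I, 2 ^ (s - k) ≤ 2 * 2 ^ (s - t) :=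
    sum_two_pow_sub_le fun k hk => ⟨(h k hk).1, (h k hk).2.trans (Nat.sub_le _ _)⟩
  have h₂ : ∑ k ∈ I, 2 ^ k ≤ 2 * 2 ^ (s - t) := sum_two_pow_le fun k hk => (h k hk).2
  have h₃ := sum_sum_two_pow_le (I := I) (s := s) fun k hk => (h k hk).2.trans (Nat.sub_le _ _)
  calc ∑ k ∈ I, ∑ k' ∈ I, (M + 1 + 2 ^ (s - max k k')) * (M + 1 + 2 ^ min k k')
      ≤ ∑ k ∈ I, ∑ k' ∈ I, ((M + 1) ^ 2 + (M + 1) * 2 ^ (s - k) + (M + 1) * 2 ^ k +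
          2 ^ (s - max k k') * 2 ^ min k k') := by
        gcongr with k _ k' _
        have e₁ : 2 ^ (s - max k k') ≤ 2 ^ (s - k) := Nat.pow_le_pow_right two_pos (by omega)
        have e₂ : 2 ^ min k k' ≤ 2 ^ k := Nat.pow_le_pow_right two_pos (by omega)
        have e₃ := Nat.mul_le_mul_left (M + 1) e₁
        have e₄ := Nat.mul_le_mul_left (M + 1) e₂
        linarith
    _ = (M + 1) ^ 2 * I.card ^ 2 + I.card * ((M + 1) * ∑ k ∈ I, 2 ^ (s - k)) +
          I.card * ((M + 1) * ∑ k ∈ I, 2 ^ k) +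
          ∑ k ∈ I, ∑ k' ∈ I, 2 ^ (s - max k k') * 2 ^ min k k' := by
        simp only [Finset.sum_add_distrib, Finset.sum_const, smul_eq_mul, ← Finset.mul_sum]
        ring
    _ ≤ (M + 1) ^ 2 * I.card ^ 2 + I.card * ((M + 1) * (2 * 2 ^ (s - t))) +
          I.card * ((M + 1) * (2 * 2 ^ (s - t))) + 4 * I.card * 2 ^ s := by gcongr
    _ = _ := by ring

theorem four_mul_le_two_pow {t : ℕ} (ht : 8 ≤ t) : 4 * t ≤ 2 ^ t := by
  induction t, ht using Nat.le_induction with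
  | base => norm_num
  | succ t ht ih => rw [pow_succ]; omega

/-! ### The capacity of the family of rectangles -/

namespace BiTree

variable {N : ℕ∞}

/-- `q` is a rectangle of relative generations `a` and `b` in the South-West corner of the `j`-th
diagonal square of side `2 ^ (-M)`. -/
def IsCornerRect (M a b j : ℕ) (q : BiTree N) : Prop :=
  q.1.IsCorner M a j ∧ q.2.IsCorner M b j

theorem IsCornerRect.exists {M a b j : ℕ} (ha : ((M + a : ℕ) : ℕ∞) ≤ N)
    (hb : ((M + b : ℕ) : ℕ∞) ≤ N) (hj : j < 2 ^ M) :
    ∃ q : BiTree N, IsCornerRect M a b j q := by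
  obtain ⟨x, hx⟩ := DyadicTree.IsCorner.exists ha hj
  obtain ⟨y, hy⟩ := DyadicTree.IsCorner.exists hb hj
  exact ⟨(x, y), hx, hy⟩

theorem common_le_mul {M a b a' b' j j' : ℕ} {p q : BiTree N} (hp : IsCornerRect M a b j p)
    (hq : IsCornerRect M a' b' j' q) :
    common p q ≤ (M + 1 + min a a') * (M + 1 + min b b') := by
  rw [common_eq_mul]
  have h₁ := DyadicTree.common_le_left p.1 q.1
  have h₂ := DyadicTree.common_le_right p.1 q.1
  have h₃ := DyadicTree.common_le_left p.2 q.2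
  have h₄ := DyadicTree.common_le_right p.2 q.2
  rw [hp.1.1] at h₁
  rw [hq.1.1] at h₂
  rw [hp.2.1] at h₃
  rw [hq.2.1] at h₄
  exact Nat.mul_le_mul (by omega) (by omega)

theorem common_le_sq_agree {M a b a' b' j j' : ℕ} {p q : BiTree N} (hp : IsCornerRect M a b j p)
    (hq : IsCornerRect M a' b' j' q) (hj : j ≠ j') : common p q ≤ (agree M j j').card ^ 2 := by
  rw [common_eq_mul, sq]
  exact Nat.mul_le_mul (hp.1.common_le_agree hq.1 hj) (hp.2.common_le_agree hq.2 hj)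

/-- The uniform probability measure on the rectangles `q_{jk}` has energy at most `23`. -/
theorem sum_common_le {s t M : ℕ} (ht : 8 ≤ t) (hs : s = 2 ^ t) (hM : M + t = s)
    {p : ℕ × ℕ → BiTree N} (hp : ∀ i ∈ Finset.range (2 ^ M) ×ˢ Finset.Icc t (s - t),
      IsCornerRect M (2 ^ (s - i.2)) (2 ^ i.2) i.1 (p i)) :
    ∑ i ∈ Finset.range (2 ^ M) ×ˢ Finset.Icc t (s - t),
      ∑ i' ∈ Finset.range (2 ^ M) ×ˢ Finset.Icc t (s - t), common (p i) (p i') ≤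
        23 * (Finset.range (2 ^ M) ×ˢ Finset.Icc t (s - t)).card ^ 2 := by
  set I := Finset.Icc t (s - t) with hI
  have hst := four_mul_le_two_pow ht
  rw [← hs] at hst
  have hK : I.card = s - t + 1 - t := by rw [hI, Nat.card_Icc]
  let A : ℕ → ℕ → ℕ := fun j j' => (agree M j j').card ^ 2
  let B : ℕ → ℕ → ℕ := fun k k' => (M + 1 + 2 ^ (s - max k k')) * (M + 1 + 2 ^ min k k')
  have hterm : ∀ i ∈ Finset.range (2 ^ M) ×ˢ I, ∀ i' ∈ Finset.range (2 ^ M) ×ˢ I,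
      common (p i) (p i') ≤ A i.1 i'.1 + if i.1 = i'.1 then B i.2 i'.2 else 0 := by
    intro i hi i' hi'
    by_cases hj : i.1 = i'.1
    · rw [if_pos hj]
      refine le_trans ?_ (Nat.le_add_left _ _)
      refine (common_le_mul (hp i hi) (hp i' hi')).trans (Nat.mul_le_mul ?_ ?_)
      · rcases le_total i.2 i'.2 with h | h <;> simp [h]
      · rcases le_total i.2 i'.2 with h | h <;> simp [h]
    · exact (common_le_sq_agree (hp i hi) (hp i' hi') hj).trans (Nat.le_add_right _ _)
  have hrow : ∀ i ∈ Finset.range (2 ^ M) ×ˢ I,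
      ∑ i' ∈ Finset.range (2 ^ M) ×ˢ I, common (p i) (p i') ≤
        I.card * (6 * 2 ^ M) + ∑ k' ∈ I, B i.2 k' := by
    intro i hi
    refine (Finset.sum_le_sum (hterm i hi)).trans ?_
    rw [Finset.sum_add_distrib, Finset.sum_product, Finset.sum_product]
    have h₁ : ∑ j' ∈ Finset.range (2 ^ M), ∑ _k' ∈ I, A i.1 j' ≤ I.card * (6 * 2 ^ M) := by
      simp only [Finset.sum_const, smul_eq_mul, ← Finset.mul_sum]
      exact Nat.mul_le_mul_left _ (sum_sq_agree_le M i.1)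
    have h₂ : ∑ j' ∈ Finset.range (2 ^ M), ∑ k' ∈ I, (if i.1 = j' then B i.2 k' else 0) =
        ∑ k' ∈ I, B i.2 k' := by
      rw [Finset.sum_comm]
      refine Finset.sum_congr rfl fun k' _ => ?_
      rw [Finset.sum_ite_eq, if_pos (Finset.mem_product.1 hi).1]
    exact add_le_add h₁ h₂.le
  have hB := sum_sum_overlap_le (I := I) (s := s) (t := t) (M := M)
    fun k hk => Finset.mem_Icc.1 hk
  rw [show s - t = M by omega] at hB
  have hPs : 2 ^ s = 2 ^ M * s := by rw [← hM, pow_add, hM, ← hs]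
  have hP : s ^ 2 ≤ 2 ^ M := by
    rw [hs, ← pow_mul]
    exact Nat.pow_le_pow_right two_pos (by omega)
  have hMs : M + 1 ≤ s := by omega
  have hsK : s ≤ 2 * I.card := by omega
  refine (Finset.sum_le_sum hrow).trans ?_
  rw [Finset.sum_product]
  simp only [Finset.sum_add_distrib, Finset.sum_const, smul_eq_mul, Finset.card_range,
    Finset.card_product]
  rw [hPs] at hB
  set P := 2 ^ M
  set K := I.card
  have hB' : ∑ k ∈ I, ∑ k' ∈ I, B k k' ≤ 17 * P * K ^ 2 := by
    refine hB.trans ?_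
    calc (M + 1) ^ 2 * K ^ 2 + 4 * (M + 1) * K * P + 4 * K * (P * s)
        ≤ P * K ^ 2 + 4 * (2 * K) * K * P + 4 * K * (P * (2 * K)) := by
          gcongr
          · exact (Nat.pow_le_pow_left hMs 2).trans hP
          · exact hMs.trans hsK
      _ = 17 * P * K ^ 2 := by ring
  calc P * (K * (K * (6 * P))) + P * ∑ k ∈ I, ∑ k' ∈ I, B k k'
      ≤ P * (K * (K * (6 * P))) + P * (17 * P * K ^ 2) := by gcongr
    _ = 23 * (P * K) ^ 2 := by ring

theorem le_cap_rects {s t M : ℕ} (ht : 8 ≤ t) (hs : s = 2 ^ t) (hM : M + t = s)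
    (hN : ((2 ^ s + M : ℕ) : ℕ∞) ≤ N) : ((1 / 23 : ℝ≥0) : ℝ≥0∞) ≤ cap (rects N s M t (s - t)) := by
  have hst := four_mul_le_two_pow ht
  rw [← hs] at hst
  have hgen : ∀ m ≤ s, ((M + 2 ^ m : ℕ) : ℕ∞) ≤ N := fun m hm => by
    refine le_trans ?_ hN
    have := Nat.pow_le_pow_right two_pos hm
    exact_mod_cast (by omega : M + 2 ^ m ≤ 2 ^ s + M)
  have : ∀ i : ℕ × ℕ, ∃ q : BiTree N, i ∈ Finset.range (2 ^ M) ×ˢ Finset.Icc t (s - t) →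
      IsCornerRect M (2 ^ (s - i.2)) (2 ^ i.2) i.1 q := by
    intro i
    by_cases hi : i ∈ Finset.range (2 ^ M) ×ˢ Finset.Icc t (s - t)
    · have h := Finset.mem_product.1 hi
      have hk := Finset.mem_Icc.1 h.2
      obtain ⟨q, hq⟩ := IsCornerRect.exists (hgen (s - i.2) (by omega)) (hgen i.2 (by omega))
        (Finset.mem_range.1 h.1)
      exact ⟨q, fun _ => hq⟩
    · exact ⟨(DyadicTree.root N, DyadicTree.root N), fun h => absurd h hi⟩
  choose p hp using this
  refine le_iInf₂ fun φ hφ => ?_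
  have h₁ := sq_card_le_common_mul_energy (Finset.range (2 ^ M) ×ˢ Finset.Icc t (s - t)) p φ
    fun i hi => by
      have h := Finset.mem_product.1 hi
      exact hφ _ ⟨i.1, Finset.mem_range.1 h.1, i.2, h.2, hp i hi⟩
  have h₂ := sum_common_le ht hs hM hp
  set S := Finset.range (2 ^ M) ×ˢ Finset.Icc t (s - t)
  have hS : 0 < S.card := by
    refine Finset.card_pos.2 ⟨(0, t), Finset.mem_product.2 ⟨?_, ?_⟩⟩
    · simp
    · exact Finset.mem_Icc.2 ⟨le_rfl, by omega⟩
  have hS0 : (S.card : ℝ≥0∞) ^ 2 ≠ 0 := by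
    simpa using hS.ne'
  have hStop : (S.card : ℝ≥0∞) ^ 2 ≠ ∞ := by simp
  have h₃ : (S.card : ℝ≥0∞) ^ 2 * 1 ≤ (S.card : ℝ≥0∞) ^ 2 * (23 * energy φ) := by
    calc (S.card : ℝ≥0∞) ^ 2 * 1 ≤ _ := (mul_one _).le.trans h₁
      _ ≤ ((23 * S.card ^ 2 : ℕ) : ℝ≥0∞) * energy φ := by gcongr
      _ = _ := by push_cast; ring
  rw [ENNReal.mul_le_mul_iff_right hS0 hStop] at h₃
  rw [one_div, ENNReal.coe_inv (by norm_num)]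
  refine ENNReal.inv_le_iff_le_mul (by simp) (by simp) |>.2 ?_
  simpa using h₃

theorem mul_cap_le_energy {F : Set (BiTree N)} {c : ℝ≥0} (hc : 0 < c) {φ : BiTree N → ℝ≥0}
    (h : ∀ α ∈ F, c ≤ upSum φ α) : (c : ℝ≥0∞) ^ 2 * cap F ≤ energy φ := by
  have h₁ : cap F ≤ energy fun α => c⁻¹ * φ α := by
    refine iInf₂_le _ fun α hα => ?_
    rw [upSum, ← Finset.mul_sum]
    calc (1 : ℝ≥0) = c⁻¹ * c := (inv_mul_cancel₀ hc.ne').symm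
      _ ≤ _ := by gcongr; exact h α hα
  refine (mul_le_mul_right h₁ _).trans ?_
  rw [energy, ← ENNReal.tsum_mul_left]
  refine ENNReal.tsum_le_tsum fun α => ?_
  rw [← mul_pow, ← ENNReal.coe_mul, mul_inv_cancel_left₀ hc.ne']

/-! ### The potential of the point masses -/

theorem upSum_root (g : BiTree N → ℝ≥0) :
    upSum g (DyadicTree.root N, DyadicTree.root N) = g (DyadicTree.root N, DyadicTree.root N) := by
  have : Finset.Ici ((DyadicTree.root N, DyadicTree.root N) : BiTree N) =
      {(DyadicTree.root N, DyadicTree.root N)} := by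
    ext α
    rw [Finset.mem_Ici, Finset.mem_singleton]
    exact ⟨fun h => le_antisymm (le_root α) h, fun h => h.ge⟩
  rw [upSum, this, Finset.sum_singleton]

theorem nu_mem_image {s M : ℕ} {ω : ℕ → BiTree N}
    (hω : ∀ j < 2 ^ M, IsCornerRect M (2 ^ s) (2 ^ s) j (ω j)) (γ : BiTree N)
    (h : nu N s M γ ≠ 0) : γ ∈ (Finset.range (2 ^ M)).image ω := by
  have : ∃ j < 2 ^ M, γ.1.IsCorner M (2 ^ s) j ∧ γ.2.IsCorner M (2 ^ s) j := by
    by_contra hn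
    exact h (if_neg hn)
  obtain ⟨j, hj, h₁, h₂⟩ := this
  exact Finset.mem_image.2 ⟨j, Finset.mem_range.2 hj,
    Prod.ext ((hω j hj).1.unique h₁) ((hω j hj).2.unique h₂)⟩

theorem exists_cornerRects {s M : ℕ} (hN : ((2 ^ s + M : ℕ) : ℕ∞) ≤ N) :
    ∃ ω : ℕ → BiTree N, ∀ j < 2 ^ M, IsCornerRect M (2 ^ s) (2 ^ s) j (ω j) := by
  have : ∀ j, ∃ q : BiTree N, j < 2 ^ M → IsCornerRect M (2 ^ s) (2 ^ s) j q := by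
    intro j
    by_cases hj : j < 2 ^ M
    · rw [add_comm] at hN
      obtain ⟨q, hq⟩ := IsCornerRect.exists hN hN hj
      exact ⟨q, fun _ => hq⟩
    · exact ⟨(DyadicTree.root N, DyadicTree.root N), fun h => absurd h hj⟩
  choose ω hω using this
  exact ⟨ω, hω⟩

theorem upSum_downSum_nu {s M : ℕ} {ω : ℕ → BiTree N}
    (hω : ∀ j < 2 ^ M, IsCornerRect M (2 ^ s) (2 ^ s) j (ω j)) (α : BiTree N) :
    upSum (downSum (nu N s M)) α =
      ((∑ j ∈ Finset.range (2 ^ M), common α (ω j) : ℕ) : ℝ≥0) / ((2 : ℝ≥0) ^ s) ^ 2 := by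
  rw [upSum_downSum (nu_mem_image hω), Finset.sum_image, div_eq_inv_mul]
  · push_cast
    rw [Finset.mul_sum]
    refine Finset.sum_congr rfl fun j hj => ?_
    rw [nu, if_pos ⟨j, Finset.mem_range.1 hj, hω j (Finset.mem_range.1 hj)⟩, one_div]
  · intro j hj j' hj' h
    have h₁ := hω j (Finset.mem_range.1 hj)
    rw [h] at h₁
    exact h₁.1.idx_inj (hω j' (Finset.mem_range.1 hj')).1

theorem common_root_left (α : BiTree N) :
    common (DyadicTree.root N, DyadicTree.root N) α = 1 := by
  have h : ∀ x : DyadicTree N, DyadicTree.common (DyadicTree.root N) x = 1 := fun x => by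
    rw [DyadicTree.common, Finset.inter_comm]
    exact DyadicTree.common_of_le (DyadicTree.le_root x)
  rw [common_eq_mul, h, h]

theorem downSum_nu_root {s M : ℕ} (hN : ((2 ^ s + M : ℕ) : ℕ∞) ≤ N) :
    downSum (nu N s M) (DyadicTree.root N, DyadicTree.root N) =
      (2 : ℝ≥0) ^ M / ((2 : ℝ≥0) ^ s) ^ 2 := by
  obtain ⟨ω, hω⟩ := exists_cornerRects hN
  rw [← upSum_root (downSum (nu N s M)), upSum_downSum_nu hω]
  simp [common_root_left]

theorem biSuperadditive_downSum_nu {s M : ℕ} (hN : ((2 ^ s + M : ℕ) : ℕ∞) ≤ N) :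
    BiSuperadditive (downSum (nu N s M)) := by
  obtain ⟨ω, hω⟩ := exists_cornerRects hN
  exact biSuperadditive_downSum (nu_mem_image hω)

/-- At `q_{jk}` the mass of `ω_j` alone contributes about `1 / n` to the potential, because the
product of the two relative generations of `q_{jk}` is `n`; the restriction on `k` keeps the
total contribution of all other terms below `1 / n`. -/
theorem rects_subset_levelSet {s t M : ℕ} (ht : 8 ≤ t) (hs : s = 2 ^ t) (hM : M + t = s)
    (hN : ((2 ^ s + M : ℕ) : ℕ∞) ≤ N) :
    rects N s M t (s - t) ⊆ levelSet (downSum (nu N s M)) (1 / (2 * (2 : ℝ≥0) ^ s)) := by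
  rintro q ⟨j, hj, k, hk, hq⟩
  obtain ⟨ω, hω⟩ := exists_cornerRects hN
  have hst := four_mul_le_two_pow ht
  rw [← hs] at hst
  have hk := Finset.mem_Icc.1 hk
  have hks : s - k + k = s := by omega
  have hAB : 2 ^ (s - k) * 2 ^ k = 2 ^ s := by rw [← pow_add, hks]
  have hPs : 2 ^ s = 2 ^ M * s := by rw [← hM, pow_add, hM, ← hs]
  have hcorner : IsCornerRect M (2 ^ (s - k)) (2 ^ k) j q := hq
  have hlow : 2 ^ s ≤ ∑ j' ∈ Finset.range (2 ^ M), common q (ω j') := by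
    refine le_trans ?_ (Finset.single_le_sum (f := fun j' => common q (ω j'))
      (fun _ _ => Nat.zero_le _) (Finset.mem_range.2 hj))
    have h₁ : (ω j).1 ≤ q.1 :=
      (hω j hj).1.le hq.1 (Nat.pow_le_pow_right two_pos (by omega))
    have h₂ : (ω j).2 ≤ q.2 :=
      (hω j hj).2.le hq.2 (Nat.pow_le_pow_right two_pos (by omega))
    have e₁ := DyadicTree.common_of_le h₁
    have e₂ := DyadicTree.common_of_le h₂
    rw [DyadicTree.common, Finset.inter_comm, ← DyadicTree.common, hq.1.1] at e₁
    rw [DyadicTree.common, Finset.inter_comm, ← DyadicTree.common, hq.2.1] at e₂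
    simp only [common_eq_mul, e₁, e₂]
    rw [← hAB]
    exact Nat.mul_le_mul (by omega) (by omega)
  have hup : ∑ j' ∈ Finset.range (2 ^ M), common q (ω j') ≤ 2 * 2 ^ s := by
    calc ∑ j' ∈ Finset.range (2 ^ M), common q (ω j')
        ≤ ∑ j' ∈ Finset.range (2 ^ M), ((agree M j j').card ^ 2 +
            if j = j' then (M + 1 + 2 ^ (s - k)) * (M + 1 + 2 ^ k) else 0) := by
          refine Finset.sum_le_sum fun j' hj' => ?_
          have hω' := hω j' (Finset.mem_range.1 hj')
          by_cases h : j = j'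
          · rw [if_pos h]
            refine le_trans ?_ (Nat.le_add_left _ _)
            exact (common_le_mul hcorner hω').trans (Nat.mul_le_mul (by omega) (by omega))
          · exact (common_le_sq_agree hcorner hω' h).trans (Nat.le_add_right _ _)
      _ ≤ 6 * 2 ^ M + (M + 1 + 2 ^ (s - k)) * (M + 1 + 2 ^ k) := by
          rw [Finset.sum_add_distrib, Finset.sum_ite_eq, if_pos (Finset.mem_range.2 hj)]
          gcongr
          exact sum_sq_agree_le M j
      _ ≤ 2 * 2 ^ s := by
          have hA : s ≤ 2 ^ (s - k) :=
            hs.le.trans (Nat.pow_le_pow_right two_pos (by omega))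
          have hB : s ≤ 2 ^ k := hs.le.trans (Nat.pow_le_pow_right two_pos hk.1)
          have hP : 2 * s ^ 2 ≤ 2 ^ M := by
            rw [hs, ← pow_mul, ← pow_succ']
            exact Nat.pow_le_pow_right two_pos (by omega)
          have hM7 : M + 8 ≤ s := by omega
          have hs0 : 0 < s := by omega
          rw [hPs] at hAB ⊢
          generalize 2 ^ (s - k) = A at *
          generalize 2 ^ k = B at *
          generalize 2 ^ M = P at *
          -- `A * B = P * s` with both factors at least `s`: the sum is largest for `A = s`, `B = P`
          have hsum : A + B ≤ P + s := by
            obtain ⟨a, rfl⟩ := Nat.exists_eq_add_of_le hA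
            obtain ⟨b, rfl⟩ := Nat.exists_eq_add_of_le hB
            have : s * (s + a + (s + b)) ≤ s * (P + s) := by nlinarith [Nat.zero_le (a * b)]
            exact Nat.le_of_mul_le_mul_left this hs0
          obtain ⟨r, rfl⟩ := Nat.exists_eq_add_of_le hM7
          have := Nat.mul_le_mul_left (M + 1) hsum
          nlinarith
  constructor
  · rw [upSum_downSum_nu hω, le_div_iff₀ (by positivity)]
    have : ((2 ^ s : ℕ) : ℝ≥0) ≤ ((∑ j' ∈ Finset.range (2 ^ M), common q (ω j') : ℕ) : ℝ≥0) :=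
      Nat.cast_le.2 hlow
    refine le_trans (le_of_eq ?_) this
    push_cast
    field_simp
  · rw [upSum_downSum_nu hω, div_le_iff₀ (by positivity)]
    have : ((∑ j' ∈ Finset.range (2 ^ M), common q (ω j') : ℕ) : ℝ≥0) ≤ ((2 * 2 ^ s : ℕ) : ℝ≥0) :=
      Nat.cast_le.2 hup
    refine this.trans (le_of_eq ?_)
    push_cast
    field_simp
    norm_num

end BiTree

/-! ### Failure of the majorization -/

namespace BiTree

variable {N : ℕ∞}

theorem majorizationData_rootDelta {s t M : ℕ} (ht : 8 ≤ t) (hs : s = 2 ^ t) (hM : M + t = s)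
    (hN : ((2 ^ s + M : ℕ) : ℕ∞) ≤ N) :
    downSum (nu N s M) (DyadicTree.root N, DyadicTree.root N) = 1 / ((2 : ℝ≥0) ^ s * s) ∧
      MajorizationData (rootDelta N) (downSum (nu N s M)) (1 / ((2 : ℝ≥0) ^ s * s))
        (1 / (2 * (2 : ℝ≥0) ^ s)) := by
  have hst := four_mul_le_two_pow ht
  rw [← hs] at hst
  have hs0 : (0 : ℝ≥0) < s := by exact_mod_cast (by omega : 0 < s)
  have hroot : downSum (nu N s M) (DyadicTree.root N, DyadicTree.root N) =
      1 / ((2 : ℝ≥0) ^ s * s) := by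
    have hPs : (2 : ℝ≥0) ^ s = 2 ^ M * s := by
      rw [← hM, pow_add, hM, hs]
      push_cast
      rfl
    rw [downSum_nu_root hN, hPs]
    field_simp
  refine ⟨hroot, by positivity, ?_, ?_, ?_⟩
  · have h : (20 : ℝ≥0) ≤ s := by exact_mod_cast (by omega : 20 ≤ s)
    rw [mul_one_div, div_le_div_iff₀ (by positivity) (by positivity)]
    calc (10 : ℝ≥0) * (2 * 2 ^ s) = 2 ^ s * 20 := by ring
      _ ≤ 2 ^ s * s := by gcongr
      _ = 1 * (2 ^ s * s) := (one_mul _).symm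
  · rw [← downSum_rootDelta]
    exact biSuperadditive_downSum mem_singleton_of_rootDelta_ne_zero
  · intro α hα
    rw [Finset.mem_singleton.1 (mem_singleton_of_rootDelta_ne_zero α hα), upSum_root, hroot]

/-- A majorant has energy at least the capacity of the level set, which is bounded below, while
small energy majorization would allow only `C δ / lam = 2 C / log n`. -/
theorem le_of_isMajorant {s t M : ℕ} (ht : 8 ≤ t) (hs : s = 2 ^ t) (hM : M + t = s)
    (hN : ((2 ^ s + M : ℕ) : ℕ∞) ≤ N) {C : ℝ≥0} {φ : BiTree N → ℝ≥0}
    (h : IsMajorant C (rootDelta N) (downSum (nu N s M)) (1 / ((2 : ℝ≥0) ^ s * s))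
      (1 / (2 * (2 : ℝ≥0) ^ s)) φ) : 1 / 23 * (s : ℝ≥0) ≤ 2 * C := by
  have hs0 : (0 : ℝ≥0) < s := by
    rw [hs]
    push_cast
    positivity
  have h₁ : cap (rects N s M t (s - t)) ≤ energy φ := iInf₂_le φ fun α hα =>
    (upSum_rootDelta α).ge.trans (h.1 α (rects_subset_levelSet ht hs hM hN hα))
  have h₂ := (le_cap_rects ht hs hM hN).trans (h₁.trans h.2)
  rw [energy_rootDelta, mul_one, ENNReal.coe_le_coe] at h₂
  calc 1 / 23 * (s : ℝ≥0)
      ≤ C * (1 / ((2 : ℝ≥0) ^ s * s) / (1 / (2 * (2 : ℝ≥0) ^ s))) * s := by gcongr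
    _ = 2 * C := by field_simp

/-- Arbitrarily large parameters `s = 2 ^ t`, `M = s - t` of the example. -/
theorem exists_parameters (A : ℝ≥0) :
    ∃ t s M : ℕ, 8 ≤ t ∧ s = 2 ^ t ∧ M + t = s ∧ A < s := by
  obtain ⟨m, hm⟩ := pow_unbounded_of_one_lt A (one_lt_two : (1 : ℝ≥0) < 2)
  refine ⟨max 8 m, 2 ^ max 8 m, 2 ^ max 8 m - max 8 m, le_max_left _ _, rfl,
    Nat.sub_add_cancel Nat.lt_two_pow_self.le, hm.trans_le ?_⟩
  push_cast
  exact pow_le_pow_right₀ one_le_two (le_max_right _ _)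

theorem not_majorization (C : ℝ≥0) :
    ∃ N₀ : ℕ, ∀ N : ℕ∞, (N₀ : ℕ∞) ≤ N → ¬ Majorization N C := by
  obtain ⟨t, s, M, ht, hs, hM, hlt⟩ := exists_parameters (46 * C)
  refine ⟨2 ^ s + M, fun N hN h => ?_⟩
  obtain ⟨φ, hφ⟩ := h _ _ _ _ (majorizationData_rootDelta ht hs hM hN).2
  have h₁ := le_of_isMajorant ht hs hM hN hφ
  refine hlt.not_ge ?_
  calc (s : ℝ≥0) = 23 * (1 / 23 * s) := by field_simp
    _ ≤ 23 * (2 * C) := by gcongr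
    _ = 46 * C := by ring

/-- The example has superadditive `g`, so with weight `w = 1` it also refutes the weighted
version. -/
theorem not_weightedMajorization {c : ℝ≥0} (C : ℝ≥0) (hc : 0 < c) :
    ∃ N₀ : ℕ, ∀ N : ℕ∞, (N₀ : ℕ∞) ≤ N → ¬ WeightedMajorization N c C := by
  obtain ⟨t, s, M, ht, hs, hM, hlt⟩ := exists_parameters (23 * C / c ^ 2)
  refine ⟨2 ^ s + M, fun N hN h => ?_⟩
  have hs0 : (0 : ℝ≥0) < s := by
    rw [hs]
    push_cast
    positivity
  obtain ⟨hδ, -, -, hsupp⟩ := (majorizationData_rootDelta ht hs hM hN).2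
  -- the window `(lam / 2, 2 lam]` with `lam = 1 / n` is `(1 / (2 n), 2 / n]` and contains
  -- the values `[1 / n, 2 / n]` that `𝕀 g` takes on the rectangles `q_{jk}`
  obtain ⟨φ, hφ, hφE⟩ := h (rootDelta N) (downSum (nu N s M)) (fun _ => 1)
    (1 / ((2 : ℝ≥0) ^ s * s)) (1 / (2 ^ s)) hδ (by positivity)
    (biSuperadditive_downSum_nu hN) (by simpa only [one_mul] using hsupp)
  simp only [one_mul, ENNReal.coe_one] at hφ hφE
  have h₁ : (c : ℝ≥0∞) ^ 2 * cap (rects N s M t (s - t)) ≤ energy φ := by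
    refine mul_cap_le_energy hc fun α hα => ?_
    obtain ⟨hl, hu⟩ := rects_subset_levelSet ht hs hM hN hα
    have e : (2 : ℝ≥0) * (1 / (2 * 2 ^ s)) = 1 / 2 ^ s := by field_simp
    have := hφ α (lt_of_lt_of_le (half_lt_self (by positivity)) (e.ge.trans hl))
      (hu.trans (le_of_eq (by rw [← e]; ring)))
    rwa [upSum_rootDelta, mul_one] at this
  have hE : ∑' α, ((rootDelta N α : ℝ≥0) : ℝ≥0∞) ^ 2 = 1 := energy_rootDelta
  have h₂ : (c : ℝ≥0∞) ^ 2 * ((1 / 23 : ℝ≥0) : ℝ≥0∞) ≤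
      ((C * (1 / ((2 : ℝ≥0) ^ s * s) / (1 / 2 ^ s)) : ℝ≥0) : ℝ≥0∞) := by
    rw [hE, mul_one] at hφE
    exact (mul_le_mul_right (le_cap_rects ht hs hM hN) _).trans (h₁.trans hφE)
  rw [← ENNReal.coe_pow, ← ENNReal.coe_mul, ENNReal.coe_le_coe] at h₂
  refine hlt.not_ge ?_
  rw [le_div_iff₀ (by positivity)]
  calc (s : ℝ≥0) * c ^ 2 = 23 * s * (c ^ 2 * (1 / 23)) := by field_simp
    _ ≤ 23 * s * (C * (1 / ((2 : ℝ≥0) ^ s * s) / (1 / 2 ^ s))) := by gcongr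
    _ = 23 * C := by field_simp

end BiTree

theorem mainTheorem5 :
    -- the conjecture fails: no constant works for all large depths, nor on the infinite bi-tree
    (∀ C : ℝ≥0, ∃ N₀ : ℕ, ∀ N : ℕ∞, (N₀ : ℕ∞) ≤ N → ¬ BiTree.Majorization N C) ∧
    (∀ c C : ℝ≥0, 0 < c → ∃ N₀ : ℕ, ∀ N : ℕ∞, (N₀ : ℕ∞) ≤ N →
      ¬ BiTree.WeightedMajorization N c C) ∧
    -- the explicit example, with `n = 2 ^ s`, `s = log n`, `t = log log n`, `2 ^ M = n / log n`
    (∃ c : ℝ≥0, 0 < c ∧ ∃ t₀ : ℕ, ∀ t s n M : ℕ, t₀ ≤ t → s = 2 ^ t → n = 2 ^ s →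
      2 ^ M * s = n → ∀ N : ℕ∞, ((n + M : ℕ) : ℕ∞) ≤ N →
      ∀ (f g : BiTree N → ℝ≥0) (δ lam : ℝ≥0),
        f = BiTree.rootDelta N → g = BiTree.downSum (BiTree.nu N s M) →
        δ = 1 / ((n : ℝ≥0) * s) → lam = 1 / (2 * (n : ℝ≥0)) →
        f = BiTree.downSum (BiTree.rootDelta N) ∧
        BiTree.MajorizationData f g δ lam ∧
        BiTree.BiSuperadditive g ∧
        g (DyadicTree.root N, DyadicTree.root N) = δ ∧
        (∀ α, BiTree.upSum f α = 1) ∧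
        BiTree.rects N s M t (s - t) ⊆ BiTree.levelSet g lam ∧
        ((c : ℝ≥0∞) ≤ BiTree.cap (BiTree.rects N s M t (s - t)) ∧
          BiTree.cap (BiTree.rects N s M t (s - t)) ≤ 1) ∧
        ((c : ℝ≥0∞) ≤ BiTree.cap (BiTree.rects N s M 0 s) ∧
          BiTree.cap (BiTree.rects N s M 0 s) ≤ 1) ∧
        ∀ (C : ℝ≥0) (φ : BiTree N → ℝ≥0),
          BiTree.IsMajorant C f g δ lam φ → c * s ≤ 2 * C) := by
  refine ⟨BiTree.not_majorization, fun c C hc => BiTree.not_weightedMajorization C hc,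
    1 / 23, by positivity, 8, ?_⟩
  rintro t s n M ht hs rfl hMn N hN f g δ lam rfl rfl rfl rfl
  have hM : M + t = s := by
    refine Nat.pow_right_injective le_rfl ?_
    simpa only [pow_add, ← hs] using hMn
  obtain ⟨hroot, hdata⟩ := BiTree.majorizationData_rootDelta ht hs hM hN
  have hcap := BiTree.le_cap_rects ht hs hM hN
  have hsub : BiTree.rects N s M t (s - t) ⊆ BiTree.rects N s M 0 s := by
    rintro q ⟨j, hj, k, hk, hq⟩
    refine ⟨j, hj, k, Finset.mem_Icc.2 ⟨Nat.zero_le _, ?_⟩, hq⟩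
    exact (Finset.mem_Icc.1 hk).2.trans (Nat.sub_le _ _)
  rw [Nat.cast_pow, Nat.cast_ofNat]
  exact ⟨BiTree.downSum_rootDelta.symm, hdata, BiTree.biSuperadditive_downSum_nu hN, hroot,
    BiTree.upSum_rootDelta, BiTree.rects_subset_levelSet ht hs hM hN,
    ⟨hcap, BiTree.cap_le_one _⟩, ⟨hcap.trans (BiTree.cap_mono hsub), BiTree.cap_le_one _⟩,
    fun C φ h => BiTree.le_of_isMajorant ht hs hM hN h⟩
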